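/- Fix a field $\mathbb{F}$ and an integer $k\ge 3$. A polynomial calculus (PC) derivation of a polynomial $r$ from a set $S$ of polynomials over $\mathbb{F}$ is a finite sequence of polynomials ending in $r$, each of which is a Boolean axiom $x^2-x$ for a variable $x$, an element of $S$, a linear combination $\alpha p+\beta q$ ($\alpha,\beta\in\mathbb{F}$) of two earlier members $p,q$, or a product $xp$ of a variable $x$ and an earlier member $p$. Its degree is the maximal total degree of its members. A PC refutation of $S$ is a derivation of $1$ from $S$. An equation $q=q'$ below stands for the polynomial $q-q'$. For a graph $G$, the $k$-colouring constraints, in variables $x_{v,j}$ ($v\in V(G)$, $j\in[k]$), are $\sum_{j=1}^k x_{v,j}=1$ for $v\in V(G)$; $x_{v,j}x_{v,j'}=0$ for $v\in V(G)$, $j\ne j'$; and $x_{u,j}x_{v,j}=0$ for $(u,v)\in E(G)$, $j\in[k]$. Let $B$ be a bipartite graph with finite left side $I$ (pigeons) and right side $J$ (holes) in which every $i\in I$ has a set $J(i)$ of exactly $k$ neighbours. The functional pigeonhole constraints over $B$, in variables $p_{i,j}$ ($i\in I$, $j\in J(i)$), are $\sum_{j\in J(i)}p_{i,j}=1$ for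 $i\in I$; $p_{i,j}p_{i,j'}=0$ for $i\in I$, $j\ne j'\in J(i)$; and $p_{i,j}p_{i',j}=0$ for $i\ne i'\in I$, $j\in J(i)\cap J(i')$. A graph $G=G(B)$ is constructed from $B$ as follows. For every pigeon, number its $k$ edges by $1,\dots,k$ in an arbitrary way. $G$ has a vertex for every pigeon, and further vertices $\gamma_1,\dots,\gamma_M$, where any two distinct vertices in a segment $\{\gamma_t,\dots,\gamma_{t+k-1}\}$ of $k$ consecutive ones are adjacent. For all $i\ne i'$ in $I$ and $c,c'\in[k]$ such that the $c$th edge of $i$ and the $c'$th edge of $i'$ lead to the same hole, add a gadget: two new $k$-cliques $\ell_1,\dots,\ell_k$ and $r_1,\dots,r_k$; edges from $\ell_1$ to $i$ and from $r_1$ to $i'$; edges from $\ell_2,\dots,\ell_{k-1}$ to a vertex $w=\gamma_t$ and from $r_2,\dots,r_{k-1}$ to a vertex $w'=\gamma_{t'}$, with $t\equiv c$ and $t'\equiv c' \pmod k$; if $c=c'$, an edge between $\ell_k$ and $r_k$, and if $c\ne c'$, the vertices $\ell_k$ and $r_k$ are identified. (The gadget is symmetric in $(i,c)$ and $(i',c')$;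 it may be added once for every unordered pair of pigeons or once for each order.) Here $M$ is large enough that the vertices $w,w'$ of all gadgets can be, and they are, chosen pairwise distinct. Then, for all choices made in this construction: if the $k$-colouring constraints for $G(B)$ have a PC refutation over $\mathbb{F}$ of degree $d$, then the functional pigeonhole constraints over $B$ have a PC refutation over $\mathbb{F}$ of degree at most $2d$. -/

import Mathlib

/-! ### Polynomial calculus -/

section PolynomialCalculus

variable {σ F : Type*} [Field F]

/-- `p` follows in one step of polynomial calculus from the initial polynomials `S` and the
previously derived polynomials `prev`. -/
inductive PCStep (S prev : Set (MvPolynomial σ F)) : MvPolynomial σ F → Prop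
  | boolean (x : σ) : PCStep S prev (MvPolynomial.X x ^ 2 - MvPolynomial.X x)
  | initial (q : MvPolynomial σ F) (hq : q ∈ S) : PCStep S prev q
  | linear (a b : F) (p q : MvPolynomial σ F) (hp : p ∈ prev) (hq : q ∈ prev) :
      PCStep S prev (MvPolynomial.C a * p + MvPolynomial.C b * q)
  | mul (x : σ) (p : MvPolynomial σ F) (hp : p ∈ prev) :
      PCStep S prev (MvPolynomial.X x * p)

/-- A polynomial calculus derivation of `r` from `S`: a finite non-empty sequence of polynomials
ending in `r`, each of which follows from `S` and strictly earlier members in one step. -/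
structure PCDerivation (S : Set (MvPolynomial σ F)) (r : MvPolynomial σ F) where
  steps : ℕ
  line : Fin (steps + 1) → MvPolynomial σ F
  line_last : line (Fin.last steps) = r
  valid : ∀ t, PCStep S {q | ∃ s, s < t ∧ line s = q} (line t)

/-- The degree of a derivation is the maximum total degree of its lines. -/
def PCDerivation.degree {S : Set (MvPolynomial σ F)} {r : MvPolynomial σ F}
    (π : PCDerivation S r) : ℕ :=
  Finset.univ.sup fun t => (π.line t).totalDegree

/-- A refutation is a derivation of the constant `1`. -/
abbrev PCRefutation (S : Set (MvPolynomial σ F)) : Type _ :=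
  PCDerivation S 1

end PolynomialCalculus

/-! ### The `k`-colouring constraints -/

/-- The `0/1` encoding of `k`-colourability of a graph; the variable `(v, j)` says that `v` has
colour `j`. A polynomial `q` stands for the equation `q = 0`. -/
def colouringConstraints (F : Type*) [Field F] {V : Type*} (G : SimpleGraph V) (k : ℕ) :
    Set (MvPolynomial (V × Fin k) F) :=
  {q | ∃ v : V, q = (∑ j : Fin k, MvPolynomial.X (v, j)) - 1} ∪
  {q | ∃ (v : V) (j j' : Fin k), j ≠ j' ∧ q = MvPolynomial.X (v, j) * MvPolynomial.X (v, j')} ∪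
  {q | ∃ (u v : V) (j : Fin k), G.Adj u v ∧ q = MvPolynomial.X (u, j) * MvPolynomial.X (v, j)}

/-! ### The functional pigeonhole principle over a bipartite graph -/

/-- A bipartite graph with left side `I` (pigeons), right side `J` (holes), in which every left
vertex `i` has exactly `k` neighbours, the set of which is `holes i`. -/
structure LeftRegularBipartite (I J : Type*) (k : ℕ) where
  holes : I → Finset J
  card_holes : ∀ i, (holes i).card = k

namespace LeftRegularBipartite

variable {I J : Type*} {k : ℕ}

/-- The variables `p_{i,j}` of the functional pigeonhole principle: one for each edge `(i, j)`. -/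
abbrev PigeonVar (B : LeftRegularBipartite I J k) : Type _ :=
  (i : I) × {j : J // j ∈ B.holes i}

/-- The functional pigeonhole principle constraints over `B`. -/
def fphpConstraints (F : Type*) [Field F] (B : LeftRegularBipartite I J k) :
    Set (MvPolynomial B.PigeonVar F) :=
  {q | ∃ i : I, q = (∑ j : {j : J // j ∈ B.holes i}, MvPolynomial.X ⟨i, j⟩) - 1} ∪
  {q | ∃ (i : I) (j j' : {j : J // j ∈ B.holes i}), j ≠ j' ∧
    q = MvPolynomial.X ⟨i, j⟩ * MvPolynomial.X ⟨i, j'⟩} ∪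
  {q | ∃ (i i' : I) (j : J) (hj : j ∈ B.holes i) (hj' : j ∈ B.holes i'), i ≠ i' ∧
    q = MvPolynomial.X ⟨i, ⟨j, hj⟩⟩ * MvPolynomial.X ⟨i', ⟨j, hj'⟩⟩}

/-! ### The graph `G(B)`

Colours, the edges at a pigeon, the vertices of the cliques and the vertices of the pre-colouring
gadget are all numbered from `0`. -/

/-- An enumeration, for every pigeon `i`, of the `k` edges at `i` by the colours. -/
abbrev EdgeLabelling (B : LeftRegularBipartite I J k) : Type _ :=
  ∀ i : I, Fin k ≃ {j : J // j ∈ B.holes i}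

/-- The tuples `(i, i', c, c')` with `i ≠ i'` such that the `c`th edge of pigeon `i` and the
`c'`th edge of pigeon `i'` lead to the same hole. -/
structure Conflict (B : LeftRegularBipartite I J k) (e : B.EdgeLabelling) where
  i : I
  i' : I
  c : Fin k
  c' : Fin k
  ne : i ≠ i'
  same_hole : (e i c : J) = (e i' c' : J)

/-- The same conflict with the two pigeons listed in the opposite order. -/
def Conflict.swap {B : LeftRegularBipartite I J k} {e : B.EdgeLabelling} (g : B.Conflict e) :
    B.Conflict e :=
  ⟨g.i', g.i, g.c', g.c, g.ne.symm, g.same_hole.symm⟩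

/-- The choices left open in the construction of the graph `G(B)`:
* the enumeration of the edges at every pigeon;
* which gadgets are present: the gadget of a conflict is symmetric in the two pigeons, and it is
  used for at least one of the two orders in which the pigeons can be listed (so one may take all
  ordered pairs, or each unordered pair once);
* the number `M` of vertices of the pre-colouring gadget;
* for each gadget `g`, the vertices of the pre-colouring gadget with which its two pre-coloured
  vertices are identified, `slot (g, false)` for the one of colour `c` and `slot (g, true)` for the
  one of colour `c'`: the position is congruent to the colour modulo `k`, and no position is
  used twice. -/
structure Construction (B : LeftRegularBipartite I J k) where
  edge : B.EdgeLabelling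
  gadgets : Set (B.Conflict edge)
  covers : ∀ g : B.Conflict edge, g ∈ gadgets ∨ g.swap ∈ gadgets
  M : ℕ
  slot : gadgets × Bool → Fin M
  slot_injective : Function.Injective slot
  slot_left : ∀ g : gadgets, (slot (g, false) : ℕ) % k = (g.1.c : ℕ)
  slot_right : ∀ g : gadgets, (slot (g, true) : ℕ) % k = (g.1.c' : ℕ)

namespace Construction

variable {B : LeftRegularBipartite I J k}

/-- The vertices of `G(B)`: the pigeons, the vertices of the left and right `k`-cliques of the
gadgets, and the vertices of the pre-colouring gadget. If `c ≠ c'` then the last vertices of the two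
cliques are one vertex, so that the right clique has no last vertex of its own. -/
inductive Vertex (K : B.Construction) : Type _
  | pigeon (i : I)
  | left (g : K.gadgets) (a : Fin k)
  | right (g : K.gadgets) (a : Fin k) (h : (a : ℕ) + 1 = k → g.1.c = g.1.c')
  | strip (t : Fin K.M)

open Classical in
/-- The `a`th vertex of the right clique of the gadget `g`. -/
noncomputable def rightVertex (K : B.Construction) (g : K.gadgets) (a : Fin k) : K.Vertex :=
  if h : (a : ℕ) + 1 = k → g.1.c = g.1.c' then Vertex.right g a h else Vertex.left g a

/-- The edges of `G(B)`, each listed in at least one direction. -/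
inductive Edge (K : B.Construction) : K.Vertex → K.Vertex → Prop
  | leftClique (g : K.gadgets) (a b : Fin k) (h : a ≠ b) :
      Edge K (Vertex.left g a) (Vertex.left g b)
  | rightClique (g : K.gadgets) (a b : Fin k) (h : a ≠ b) :
      Edge K (K.rightVertex g a) (K.rightVertex g b)
  | leftPigeon (g : K.gadgets) (a : Fin k) (h : (a : ℕ) = 0) :
      Edge K (Vertex.left g a) (Vertex.pigeon g.1.i)
  | rightPigeon (g : K.gadgets) (a : Fin k) (h : (a : ℕ) = 0) :
      Edge K (K.rightVertex g a) (Vertex.pigeon g.1.i')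
  | leftColour (g : K.gadgets) (a : Fin k) (h : 0 < (a : ℕ)) (h' : (a : ℕ) + 1 < k) :
      Edge K (Vertex.left g a) (Vertex.strip (K.slot (g, false)))
  | rightColour (g : K.gadgets) (a : Fin k) (h : 0 < (a : ℕ)) (h' : (a : ℕ) + 1 < k) :
      Edge K (K.rightVertex g a) (Vertex.strip (K.slot (g, true)))
  | join (g : K.gadgets) (a : Fin k) (h : (a : ℕ) + 1 = k) (h' : g.1.c = g.1.c') :
      Edge K (Vertex.left g a) (K.rightVertex g a)
  | segment (m : ℕ) (hm : m + k ≤ K.M) (s t : Fin K.M) (hs : (s : ℕ) ∈ Set.Ico m (m + k))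
      (ht : (t : ℕ) ∈ Set.Ico m (m + k)) (h : s ≠ t) :
      Edge K (Vertex.strip s) (Vertex.strip t)

/-- The graph `G(B)`. -/
def graph (K : B.Construction) : SimpleGraph K.Vertex :=
  SimpleGraph.fromRel K.Edge

end Construction

end LeftRegularBipartite

/-!
The colouring variables of `G(B)` are replaced by polynomials of degree at most one in the pigeonhole
variables, and the given refutation is translated line by line.

A pigeon `i` gets colour `j` exactly if it flies along its `j`th edge, so `x_{i,j}` becomes
`p_{i,e(j)}`, and the vertex `γ_t` has the constant colour `t mod k`. In the gadget of a conflict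
`(i, i', c, c')` let `u` and `u'` be the variables of the two edges concerned. As these edges lead to
the same hole, `u * u'` is an axiom, so that a solution is in exactly one of three states, `u = 1`,
`u' = 1` or `u = u' = 0`, with the indicators `u`, `u'`, `1 - u - u'`. In each state the gadget has a
proper colouring compatible with the strip and with every colour the pigeons may then have
(`exists_gadgetColouring`; the third state is where `3 ≤ k` is used). Fixing one such colouring for
every state, the indicator of "vertex `v` has colour `j`" is a sum of some of the three indicators,
hence affine.

The indicators are orthogonal idempotents modulo consequences of degree two of the pigeonhole
axioms, and therefore the images of all colouring axioms are derivable in degree two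
(`subst_boolean`, `subst_colouringConstraints`). An affine substitution does not raise degrees, and a multiplication
by a variable becomes a multiplication by an affine polynomial, which is a linear combination of
derivation steps (`mem_pcSubmodule_of_subst`). A refutation has degree at least one, as its first
line is an axiom, so the bound `2 * d` leaves room for the derivations of degree two.
-/

open MvPolynomial

/-! ### Polynomials derivable in bounded degree -/

section PolynomialCalculus

variable {σ τ F : Type*} [Field F]

theorem PCStep.mono {S A A' : Set (MvPolynomial σ F)} (hA : A ⊆ A') {p : MvPolynomial σ F}
    (h : PCStep S A p) : PCStep S A' p := by
  cases h with
  | boolean x => exact .boolean x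
  | initial q hq => exact .initial _ hq
  | linear a b p q hp hq => exact .linear a b p q (hA hp) (hA hq)
  | mul x p hp => exact .mul x p (hA hp)

/-- The lists of polynomials of degree at most `D` that are, read from the back, derivations
from `S`; the last derived polynomial is the head of the list. -/
inductive PCLines (S : Set (MvPolynomial σ F)) (D : ℕ) : List (MvPolynomial σ F) → Prop
  | nil : PCLines S D []
  | cons {p : MvPolynomial σ F} {l : List (MvPolynomial σ F)} (hl : PCLines S D l)
      (hp : PCStep S {q | q ∈ l} p) (hd : p.totalDegree ≤ D) : PCLines S D (p :: l)

namespace PCLines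

variable {S : Set (MvPolynomial σ F)} {D : ℕ}

theorem append {l l' : List (MvPolynomial σ F)} (h : PCLines S D l) (h' : PCLines S D l') :
    PCLines S D (l ++ l') := by
  induction h with
  | nil => exact h'
  | cons _ hp hd ih => exact ih.cons (hp.mono fun q hq => List.mem_append_left _ hq) hd

theorem step_getElem {l : List (MvPolynomial σ F)} (h : PCLines S D l) (n : ℕ)
    (hn : n < l.length) : PCStep S {q | ∃ (m : ℕ) (hm : m < l.length), n < m ∧ l[m] = q} l[n] := by
  induction h generalizing n with
  | nil => simp at hn
  | @cons p l _ hp _ ih =>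
    cases n with
    | zero =>
      refine hp.mono fun q hq => ?_
      obtain ⟨m, hm, rfl⟩ := List.getElem_of_mem hq
      exact ⟨m + 1, by simpa using hm, by omega, by simp⟩
    | succ n =>
      refine (ih n (by simpa using hn)).mono ?_
      rintro q ⟨m, hm, hnm, rfl⟩
      exact ⟨m + 1, by simpa using hm, by omega, by simp⟩

theorem totalDegree_le {l : List (MvPolynomial σ F)} (h : PCLines S D l) {q : MvPolynomial σ F}
    (hq : q ∈ l) : q.totalDegree ≤ D := by
  induction h with
  | nil => simp at hq
  | cons _ _ hd ih =>
    rcases List.mem_cons.1 hq with rfl | hq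
    · exact hd
    · exact ih hq

theorem exists_derivation {p : MvPolynomial σ F} {l : List (MvPolynomial σ F)}
    (h : PCLines S D (p :: l)) : ∃ π : PCDerivation S p, π.degree ≤ D := by
  refine ⟨⟨l.length, fun t => (p :: l)[(t.rev : ℕ)]'(by simp), by simp, fun t => ?_⟩, ?_⟩
  · refine (h.step_getElem t.rev (by simp)).mono ?_
    rintro q ⟨m, hm, htm, rfl⟩
    have hm' : m < l.length + 1 := hm
    refine ⟨Fin.rev ⟨m, hm'⟩, ?_, by simp⟩
    rw [Fin.lt_def]
    simp only [Fin.val_rev] at htm ⊢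
    omega
  · exact Finset.sup_le fun t _ => h.totalDegree_le (List.getElem_mem _)

end PCLines

/-- The polynomials with a derivation of degree at most `D` from `S`. Zero is included by hand: it
has no derivation if there are neither variables nor axioms. -/
def pcSubmodule (S : Set (MvPolynomial σ F)) (D : ℕ) : Submodule F (MvPolynomial σ F) where
  carrier := {p | p = 0 ∨ ∃ l, PCLines S D (p :: l)}
  zero_mem' := Or.inl rfl
  add_mem' := by
    rintro p q (rfl | ⟨l, hl⟩) (rfl | ⟨l', hl'⟩)
    · simp
    · right; simpa using ⟨l', hl'⟩
    · right; simpa using ⟨l, hl⟩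
    · refine Or.inr ⟨(p :: l) ++ (q :: l'), (hl.append hl').cons ?_ ?_⟩
      · simpa using PCStep.linear (S := S) (prev := {r | r ∈ (p :: l) ++ (q :: l')}) 1 1 p q
          (by simp) (by simp)
      · exact (totalDegree_add _ _).trans
          (max_le (hl.totalDegree_le (by simp)) (hl'.totalDegree_le (by simp)))
  smul_mem' := by
    rintro a p (rfl | ⟨l, hl⟩)
    · simp
    · refine Or.inr ⟨p :: l, hl.cons ?_ ?_⟩
      · simpa [smul_eq_C_mul] using PCStep.linear (S := S) (prev := {r | r ∈ p :: l}) a 0 p p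
          (by simp) (by simp)
      · exact (totalDegree_smul_le _ _).trans (hl.totalDegree_le (by simp))

variable {S : Set (MvPolynomial σ F)} {D : ℕ}

theorem exists_derivation_of_mem_pcSubmodule {p : MvPolynomial σ F} (h : p ∈ pcSubmodule S D)
    (hp : p ≠ 0) : ∃ π : PCDerivation S p, π.degree ≤ D := by
  obtain ⟨l, hl⟩ := h.resolve_left hp
  exact hl.exists_derivation

theorem initial_mem_pcSubmodule {p : MvPolynomial σ F} (h : p ∈ S) (hd : p.totalDegree ≤ D) :
    p ∈ pcSubmodule S D :=
  Or.inr ⟨[], PCLines.nil.cons (.initial p h) hd⟩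

theorem boolean_mem_pcSubmodule (x : σ) (hD : 2 ≤ D) : X x ^ 2 - X x ∈ pcSubmodule S D := by
  refine Or.inr ⟨[], PCLines.nil.cons (.boolean x) ((totalDegree_sub _ _).trans (max_le ?_ ?_))⟩
  · simpa using hD
  · simpa using by omega

theorem X_mul_mem_pcSubmodule (x : σ) {p : MvPolynomial σ F} (h : p ∈ pcSubmodule S D)
    (hd : p.totalDegree + 1 ≤ D) : X x * p ∈ pcSubmodule S D := by
  rcases h with rfl | ⟨l, hl⟩
  · simp
  · refine Or.inr ⟨p :: l, hl.cons (.mul x p (by simp)) ((totalDegree_mul _ _).trans ?_)⟩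
    rw [totalDegree_X]
    omega

/-- The first line of a derivation is an axiom, so if all axioms have positive degree, then so
has the derivation. -/
theorem PCDerivation.one_le_degree {r : MvPolynomial σ F} (π : PCDerivation S r)
    (hS : ∀ q ∈ S, 1 ≤ q.totalDegree) : 1 ≤ π.degree := by
  suffices h : 1 ≤ (π.line 0).totalDegree from
    h.trans (Finset.le_sup (f := fun t => (π.line t).totalDegree) (Finset.mem_univ 0))
  have h0 := π.valid 0
  generalize π.line 0 = q at h0
  cases h0 with
  | boolean x =>
    rw [sub_eq_add_neg, totalDegree_add_eq_left_of_totalDegree_lt] <;> simp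
  | initial q hq => exact hS _ hq
  | linear a b p q hp hq => simp at hp
  | mul x p hp => simp at hp

/-! ### Affine substitutions -/

variable (σ F) in
/-- The polynomials of degree at most one. -/
noncomputable def affinePolynomials : Submodule F (MvPolynomial σ F) :=
  Submodule.span F (insert 1 (Set.range X))

theorem one_mem_affinePolynomials : (1 : MvPolynomial σ F) ∈ affinePolynomials σ F :=
  Submodule.subset_span (Set.mem_insert _ _)

theorem X_mem_affinePolynomials (x : σ) : (X x : MvPolynomial σ F) ∈ affinePolynomials σ F :=
  Submodule.subset_span (Set.mem_insert_of_mem _ ⟨x, rfl⟩)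

theorem totalDegree_le_one_of_mem_affinePolynomials {f : MvPolynomial σ F}
    (hf : f ∈ affinePolynomials σ F) : f.totalDegree ≤ 1 := by
  induction hf using Submodule.span_induction with
  | mem f hf =>
    rcases hf with rfl | ⟨x, rfl⟩
    · simp
    · simp
  | zero => simp
  | add f g _ _ hf hg => exact (totalDegree_add _ _).trans (max_le hf hg)
  | smul a f _ hf => exact (totalDegree_smul_le _ _).trans hf

theorem affine_mul_mem_pcSubmodule {f p : MvPolynomial σ F} (hf : f ∈ affinePolynomials σ F)
    (h : p ∈ pcSubmodule S D) (hd : p.totalDegree + 1 ≤ D) : f * p ∈ pcSubmodule S D := by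
  induction hf using Submodule.span_induction with
  | mem f hf =>
    rcases hf with rfl | ⟨x, rfl⟩
    · simpa using h
    · exact X_mul_mem_pcSubmodule x h hd
  | zero => simp
  | add f g _ _ hf hg => rw [add_mul]; exact add_mem hf hg
  | smul a f _ hf => rw [smul_mul_assoc]; exact Submodule.smul_mem _ _ hf

theorem totalDegree_aeval_le_of_affine {φ : τ → MvPolynomial σ F}
    (hφ : ∀ x, φ x ∈ affinePolynomials σ F) (p : MvPolynomial τ F) :
    (aeval φ p).totalDegree ≤ p.totalDegree := by
  classical
  rw [aeval_def, eval₂_eq]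
  refine totalDegree_finsetSum_le fun m hm => ?_
  refine (totalDegree_mul _ _).trans ?_
  rw [algebraMap_eq, totalDegree_C, zero_add]
  refine (totalDegree_finsetProd _ _).trans (le_trans ?_ (le_totalDegree hm))
  refine Finset.sum_le_sum fun x _ => (totalDegree_pow _ _).trans ?_
  exact (Nat.mul_le_mul_left _ (totalDegree_le_one_of_mem_affinePolynomials (hφ x))).trans
    (mul_one _).le

/-- An affine substitution that maps the axioms over `τ` to polynomials derivable over `σ` maps
derivations to derivations. -/
theorem mem_pcSubmodule_of_subst {T : Set (MvPolynomial τ F)} {φ : τ → MvPolynomial σ F}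
    (hφ : ∀ x, φ x ∈ affinePolynomials σ F)
    (hbool : ∀ x, φ x ^ 2 - φ x ∈ pcSubmodule S D) (hT : ∀ q ∈ T, aeval φ q ∈ pcSubmodule S D)
    {r : MvPolynomial τ F} (π : PCDerivation T r) (hD : π.degree ≤ D) :
    aeval φ r ∈ pcSubmodule S D := by
  suffices h : ∀ t, aeval φ (π.line t) ∈ pcSubmodule S D by
    have := h (Fin.last _)
    rwa [π.line_last] at this
  intro t
  induction t using WellFoundedLT.induction with
  | ind t ih =>
    have ht := π.valid t
    have hdeg : (π.line t).totalDegree ≤ D :=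
      (Finset.le_sup (f := fun t => (π.line t).totalDegree) (Finset.mem_univ t)).trans hD
    generalize π.line t = q at ht hdeg
    cases ht with
    | boolean x => simpa using hbool x
    | initial q hq => exact hT _ hq
    | linear a b p q hp hq =>
      obtain ⟨s, hs, rfl⟩ := hp
      obtain ⟨s', hs', rfl⟩ := hq
      simp only [map_add, ← smul_eq_C_mul, map_smul]
      exact add_mem (Submodule.smul_mem _ _ (ih s hs)) (Submodule.smul_mem _ _ (ih s' hs'))
    | mul x p hp =>
      obtain ⟨s, hs, rfl⟩ := hp
      rw [map_mul, aeval_X]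
      rcases eq_or_ne (π.line s) 0 with h0 | h0
      · simp [h0]
      · refine affine_mul_mem_pcSubmodule (hφ x) (ih s hs) ?_
        rw [totalDegree_mul_of_isDomain (X_ne_zero x) h0, totalDegree_X] at hdeg
        have := totalDegree_aeval_le_of_affine hφ (π.line s)
        omega

end PolynomialCalculus

/-! ### Degrees of the colouring constraints -/

theorem one_le_totalDegree_of_mem_colouringConstraints {F V : Type*} [Field F]
    {G : SimpleGraph V} {k : ℕ} (hk : 0 < k) {q : MvPolynomial (V × Fin k) F}
    (hq : q ∈ colouringConstraints F G k) : 1 ≤ q.totalDegree := by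
  classical
  by_contra! h
  -- A polynomial of degree zero takes the same value everywhere.
  have hC := totalDegree_eq_zero_iff_eq_C.1 (Nat.lt_one_iff.1 h)
  have hconst : ∀ f, eval f q = eval 0 q := fun f => by rw [hC]; simp
  rcases hq with (⟨v, rfl⟩ | ⟨v, j, j', -, rfl⟩) | ⟨u, v, j, -, rfl⟩
  · have := hconst (Pi.single (v, ⟨0, hk⟩) 1)
    simp [Pi.single_apply] at this
  · simpa using hconst 1
  · simpa using hconst 1

/-! ### Colourings of the gadgets -/

theorem exists_injective_of_ne {α : Type*} {a b x y : α} (hab : a ≠ b)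
    (hxy : x ≠ y) : ∃ f : α → α, f.Injective ∧ f a = x ∧ f b = y := by
  classical
  refine ⟨(Equiv.swap a x).trans (Equiv.swap (Equiv.swap a x b) y), Equiv.injective _, ?_, ?_⟩
  · have h : x ≠ Equiv.swap a x b := by
      intro h
      apply hab
      apply (Equiv.swap a x).injective
      rw [← h, Equiv.swap_apply_left]
    simp [Equiv.swap_apply_of_ne_of_ne h hxy]
  · simp

/-- Colourings of the two cliques of the gadget of a conflict between colour `c` of the left pigeon
and colour `c'` of the right pigeon, one for each of three states: in state `0` the left pigeon has
colour `c`, in state `1` the right pigeon has colour `c'`, and in state `2` neither of them has.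
`left a s` is the colour of the `a`th vertex of the left clique in state `s`. -/
structure GadgetColouring {k : ℕ} (c c' : Fin k) where
  left : Fin k → Fin 3 → Fin k
  right : Fin k → Fin 3 → Fin k
  left_injective : ∀ s, Function.Injective (left · s)
  right_injective : ∀ s, Function.Injective (right · s)
  left_first : ∀ (a : Fin k), (a : ℕ) = 0 → ∀ s, left a s = c ↔ s ≠ 0
  right_first : ∀ (a : Fin k), (a : ℕ) = 0 → ∀ s, right a s = c' ↔ s ≠ 1
  left_middle : ∀ (a : Fin k), 0 < (a : ℕ) → (a : ℕ) + 1 < k → ∀ s, left a s ≠ c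
  right_middle : ∀ (a : Fin k), 0 < (a : ℕ) → (a : ℕ) + 1 < k → ∀ s, right a s ≠ c'
  last_eq : c ≠ c' → ∀ (a : Fin k), (a : ℕ) + 1 = k → left a = right a
  last_ne : c = c' → ∀ (a : Fin k), (a : ℕ) + 1 = k → ∀ s, left a s ≠ right a s

/-- A colouring of one clique is determined, up to the irrelevant colours of the middle vertices, by
the colours of its last vertex: in the state `s₀`, where the pigeon has colour `c`, the last vertex
must have colour `c`, and in the other states the first vertex has colour `c`. -/
theorem exists_cliqueColouring {k : ℕ} (hk : 2 ≤ k) (c : Fin k) (s₀ : Fin 3) (m : Fin 3 → Fin k)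
    (hm : ∀ s, m s = c ↔ s = s₀) :
    ∃ f : Fin k → Fin 3 → Fin k, (∀ s, Function.Injective (f · s)) ∧
      (∀ a : Fin k, (a : ℕ) = 0 → ∀ s, f a s = c ↔ s ≠ s₀) ∧
      (∀ a : Fin k, 0 < (a : ℕ) → (a : ℕ) + 1 < k → ∀ s, f a s ≠ c) ∧
      ∀ a : Fin k, (a : ℕ) + 1 = k → f a = m := by
  have h0 : (⟨0, by omega⟩ : Fin k) ≠ ⟨k - 1, by omega⟩ := by simp [Fin.ext_iff]; omega
  have key : ∀ s, ∃ g : Fin k → Fin k, g.Injective ∧ g ⟨k - 1, by omega⟩ = m s ∧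
      (s ≠ s₀ → g ⟨0, by omega⟩ = c) := by
    intro s
    by_cases hs : s = s₀
    · have : Nontrivial (Fin k) := ⟨_, _, h0⟩
      obtain ⟨x, hx⟩ := exists_ne (m s)
      obtain ⟨g, hg, -, hg1⟩ := exists_injective_of_ne h0 hx
      exact ⟨g, hg, hg1, fun h => absurd hs h⟩
    · obtain ⟨g, hg, hg0, hg1⟩ := exists_injective_of_ne h0 (x := c) (y := m s)
        fun h => hs ((hm s).1 h.symm)
      exact ⟨g, hg, hg1, fun _ => hg0⟩
  choose g hg hlast hfirst using key
  refine ⟨fun a s => g s a, hg, fun a ha s => ?_, fun a ha ha' s hc => ?_, fun a ha => ?_⟩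
  · obtain ⟨a, hak⟩ := a
    obtain rfl : a = 0 := ha
    refine ⟨?_, hfirst s⟩
    rintro h rfl
    exact h0 (hg s (h.trans ((hlast s).trans ((hm s).2 rfl)).symm))
  · by_cases hs : s = s₀
    · have := hg s (hc.trans ((hlast s).trans ((hm s).2 hs)).symm)
      simp [Fin.ext_iff] at this
      omega
    · have := hg s (hc.trans (hfirst s hs).symm)
      simp [Fin.ext_iff] at this
      omega
  · obtain ⟨a, hak⟩ := a
    obtain rfl : a = k - 1 := Nat.eq_sub_of_add_eq ha
    exact funext hlast

theorem exists_gadgetColouring {k : ℕ} (hk : 3 ≤ k) (c c' : Fin k) :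
    Nonempty (GadgetColouring c c') := by
  -- The colours `m s` and `m' s` of the last vertices of the two cliques in state `s`.
  obtain ⟨m, m', hm, hm', heq, hne⟩ : ∃ m m' : Fin 3 → Fin k, (∀ s, m s = c ↔ s = 0) ∧
      (∀ s, m' s = c' ↔ s = 1) ∧ (c ≠ c' → m = m') ∧ (c = c' → ∀ s, m s ≠ m' s) := by
    have hthird : ∀ x y : Fin k, ∃ z, z ≠ x ∧ z ≠ y := fun x y => by
      obtain ⟨z, hz⟩ := Finset.exists_mem_notMem_of_card_lt_card
        (s := {x, y}) (t := (Finset.univ : Finset (Fin k)))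
        ((Finset.card_le_two).trans_lt (by simpa using by omega))
      exact ⟨z, by simpa using hz.2⟩
    obtain ⟨x, hxc, hxc'⟩ := hthird c c'
    by_cases h : c = c'
    · subst h
      obtain ⟨y, hyc, hyx⟩ := hthird c x
      refine ⟨![c, x, x], ![x, c, y], ?_, ?_, by simp, ?_⟩ <;>
        simp [Fin.forall_fin_succ, hxc, hyc, hxc.symm, hyx.symm]
    · refine ⟨![c, c', x], ![c, c', x], ?_, ?_, by simp, by simp [h]⟩ <;>
        simp [Fin.forall_fin_succ, hxc, hxc', h, Ne.symm h]
  obtain ⟨f, hf, hf0, hf1, hf2⟩ := exists_cliqueColouring (by omega) c 0 m hm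
  obtain ⟨f', hf', hf0', hf1', hf2'⟩ := exists_cliqueColouring (by omega) c' 1 m' hm'
  exact ⟨⟨f, f', hf, hf', hf0, hf0', hf1, hf1',
    fun h a ha => by rw [hf2 a ha, hf2' a ha, heq h],
    fun h a ha s => by rw [hf2 a ha, hf2' a ha]; exact hne h s⟩⟩

namespace LeftRegularBipartite

/-! ### Indicators of the states of a gadget -/

section States

variable {F : Type*} [Field F] {I J : Type*} {k D : ℕ} {B : LeftRegularBipartite I J k}
  {e : B.EdgeLabelling}

theorem X_mul_X_mem_of_hole_ne (hD : 2 ≤ D) (i : I) {j j' : {j : J // j ∈ B.holes i}}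
    (h : j ≠ j') : (X ⟨i, j⟩ * X ⟨i, j'⟩ : MvPolynomial B.PigeonVar F) ∈
      pcSubmodule (B.fphpConstraints F) D :=
  initial_mem_pcSubmodule (Or.inl (Or.inr ⟨i, j, j', h, rfl⟩))
    ((totalDegree_mul _ _).trans (by simpa using hD))

theorem X_mul_X_mem_of_pigeon_ne (hD : 2 ≤ D) {i i' : I} (h : i ≠ i')
    {j : {j : J // j ∈ B.holes i}} {j' : {j : J // j ∈ B.holes i'}} (hj : (j : J) = j') :
    (X ⟨i, j⟩ * X ⟨i', j'⟩ : MvPolynomial B.PigeonVar F) ∈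
      pcSubmodule (B.fphpConstraints F) D := by
  obtain ⟨j, hj₁⟩ := j
  obtain ⟨j', hj₂⟩ := j'
  obtain rfl : j = j' := hj
  exact initial_mem_pcSubmodule (Or.inr ⟨i, i', j, hj₁, hj₂, h, rfl⟩)
    ((totalDegree_mul _ _).trans (by simpa using hD))

variable (F) in
/-- The indicators of the three states of a conflict, as in `GadgetColouring`: the left pigeon has
colour `c`; the right pigeon has colour `c'`; neither has. -/
noncomputable def Conflict.state (g : B.Conflict e) : Fin 3 → MvPolynomial B.PigeonVar F :=
  ![X ⟨g.i, e g.i g.c⟩, X ⟨g.i', e g.i' g.c'⟩, 1 - X ⟨g.i, e g.i g.c⟩ - X ⟨g.i', e g.i' g.c'⟩]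

theorem Conflict.sum_state (g : B.Conflict e) : ∑ s, g.state F s = 1 := by
  simp [Conflict.state, Fin.sum_univ_succ]

theorem Conflict.state_mem_affinePolynomials (g : B.Conflict e) (s : Fin 3) :
    g.state F s ∈ affinePolynomials B.PigeonVar F := by
  fin_cases s
  · exact X_mem_affinePolynomials _
  · exact X_mem_affinePolynomials _
  · exact sub_mem (sub_mem one_mem_affinePolynomials (X_mem_affinePolynomials _))
      (X_mem_affinePolynomials _)

theorem Conflict.state_mul_state_sub_mem (hD : 2 ≤ D) (g : B.Conflict e) (s s' : Fin 3) :
    g.state F s * g.state F s' - (if s = s' then g.state F s else 0) ∈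
      pcSubmodule (B.fphpConstraints F) D := by
  have huv := X_mul_X_mem_of_pigeon_ne (F := F) hD g.ne g.same_hole
  have hu := boolean_mem_pcSubmodule (S := B.fphpConstraints F) ⟨g.i, e g.i g.c⟩ hD
  have hv := boolean_mem_pcSubmodule (S := B.fphpConstraints F) ⟨g.i', e g.i' g.c'⟩ hD
  simp only [Conflict.state]
  generalize (X ⟨g.i, e g.i g.c⟩ : MvPolynomial B.PigeonVar F) = u at *
  generalize (X ⟨g.i', e g.i' g.c'⟩ : MvPolynomial B.PigeonVar F) = v at *
  have hu3 : u * (1 - u - v) ∈ pcSubmodule (B.fphpConstraints F) D := by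
    convert neg_mem (add_mem hu huv) using 1; ring
  have hv3 : v * (1 - u - v) ∈ pcSubmodule (B.fphpConstraints F) D := by
    convert neg_mem (add_mem hv huv) using 1; ring
  fin_cases s <;> fin_cases s' <;> simp
  · simpa [sq] using hu
  · exact huv
  · exact hu3
  · rwa [mul_comm]
  · simpa [sq] using hv
  · exact hv3
  · rwa [mul_comm]
  · rwa [mul_comm]
  · convert neg_mem (add_mem hu3 hv3) using 1; ring

variable (F) in
/-- The indicator of "a vertex has colour `j`", if its colour in state `s` of the conflict `g`
is `f s`. -/
noncomputable def Conflict.indicator (g : B.Conflict e) (f : Fin 3 → Fin k) (j : Fin k) :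
    MvPolynomial B.PigeonVar F :=
  ∑ s, if f s = j then g.state F s else 0

theorem Conflict.sum_indicator (g : B.Conflict e) (f : Fin 3 → Fin k) :
    ∑ j, g.indicator F f j = 1 := by
  simp only [Conflict.indicator]
  rw [Finset.sum_comm]
  simp [g.sum_state]

theorem Conflict.indicator_mem_affinePolynomials (g : B.Conflict e) (f : Fin 3 → Fin k)
    (j : Fin k) : g.indicator F f j ∈ affinePolynomials B.PigeonVar F := by
  refine Submodule.sum_mem _ fun s _ => ?_
  split_ifs
  · exact g.state_mem_affinePolynomials s
  · exact zero_mem _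

/-- The product of two indicators may be taken state by state. -/
theorem Conflict.indicator_mul_indicator_sub_mem (hD : 2 ≤ D) (g : B.Conflict e)
    (f f' : Fin 3 → Fin k) (j j' : Fin k) :
    g.indicator F f j * g.indicator F f' j' -
      (∑ s, if f s = j ∧ f' s = j' then g.state F s else 0) ∈
      pcSubmodule (B.fphpConstraints F) D := by
  have h : g.indicator F f j * g.indicator F f' j' -
      (∑ s, if f s = j ∧ f' s = j' then g.state F s else 0) =
      ∑ s, ∑ s', if f s = j ∧ f' s' = j' then
        g.state F s * g.state F s' - (if s = s' then g.state F s else 0) else 0 := by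
    rw [Conflict.indicator, Conflict.indicator, Finset.sum_mul_sum, ← Finset.sum_sub_distrib]
    refine Finset.sum_congr rfl fun s _ => ?_
    have : (if f s = j ∧ f' s = j' then g.state F s else 0) =
        ∑ s', if s = s' then (if f s = j ∧ f' s' = j' then g.state F s else 0) else 0 := by
      simp
    rw [this, ← Finset.sum_sub_distrib]
    refine Finset.sum_congr rfl fun s' _ => ?_
    split_ifs <;> simp_all
  rw [h]
  refine Submodule.sum_mem _ fun s _ => Submodule.sum_mem _ fun s' _ => ?_
  by_cases hs : f s = j ∧ f' s' = j'
  · rw [if_pos hs]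
    exact g.state_mul_state_sub_mem hD s s'
  · rw [if_neg hs]
    exact zero_mem _

theorem Conflict.indicator_sq_sub_mem (hD : 2 ≤ D) (g : B.Conflict e) (f : Fin 3 → Fin k)
    (j : Fin k) : g.indicator F f j ^ 2 - g.indicator F f j ∈
      pcSubmodule (B.fphpConstraints F) D := by
  simpa [sq, Conflict.indicator] using g.indicator_mul_indicator_sub_mem (F := F) hD f f j j

theorem Conflict.indicator_mul_indicator_mem (hD : 2 ≤ D) (g : B.Conflict e)
    {f f' : Fin 3 → Fin k} {j j' : Fin k} (h : ∀ s, f s = j → f' s ≠ j') :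
    g.indicator F f j * g.indicator F f' j' ∈ pcSubmodule (B.fphpConstraints F) D := by
  have h0 : (∑ s, if f s = j ∧ f' s = j' then g.state F s else 0) = 0 :=
    Finset.sum_eq_zero fun s _ => if_neg fun hs => h s hs.1 hs.2
  simpa [h0] using g.indicator_mul_indicator_sub_mem (F := F) hD f f' j j'

/-- If a vertex has colour `c` except in the state `s₀`, in which a pigeon has colour `c`, then
that pigeon and the vertex have no common colour. -/
theorem Conflict.indicator_mul_X_mem (hD : 2 ≤ D) (g : B.Conflict e) {f : Fin 3 → Fin k}
    {i : I} {c : Fin k} {s₀ : Fin 3} (hs₀ : g.state F s₀ = X ⟨i, e i c⟩)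
    (hf : ∀ s, f s = c ↔ s ≠ s₀) (j : Fin k) :
    g.indicator F f j * X ⟨i, e i j⟩ ∈ pcSubmodule (B.fphpConstraints F) D := by
  by_cases hj : j = c
  · subst hj
    have h : g.indicator F f j = 1 - X ⟨i, e i j⟩ := by
      rw [← hs₀, ← g.sum_state (F := F), Conflict.indicator, eq_sub_iff_add_eq,
        ← Finset.add_sum_erase _ _ (Finset.mem_univ s₀),
        ← Finset.add_sum_erase Finset.univ (g.state F) (Finset.mem_univ s₀),
        if_neg (by simp [hf]), zero_add, add_comm]
      congr 1
      refine Finset.sum_congr rfl fun s hs => if_pos ((hf s).2 (Finset.ne_of_mem_erase hs))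
    rw [h]
    convert neg_mem (boolean_mem_pcSubmodule (S := B.fphpConstraints F) ⟨i, e i j⟩ hD) using 1
    ring
  · have h : g.indicator F f j = if f s₀ = j then X ⟨i, e i c⟩ else 0 := by
      rw [Conflict.indicator, Finset.sum_eq_single s₀, hs₀]
      · intro s _ hs
        rw [(hf s).2 hs, if_neg (Ne.symm hj)]
      · simp
    rw [h]
    split_ifs
    · exact X_mul_X_mem_of_hole_ne hD i fun h => hj ((e i).injective h).symm
    · simp

theorem Conflict.indicator_eq_zero (g : B.Conflict e) {f : Fin 3 → Fin k} {j : Fin k}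
    (h : ∀ s, f s ≠ j) : g.indicator F f j = 0 :=
  Finset.sum_eq_zero fun s _ => if_neg (h s)

end States

/-! ### The substitution -/

namespace Construction

variable (F : Type*) [Field F] {I J : Type*} {k D : ℕ} {B : LeftRegularBipartite I J k}
  {K : B.Construction}

/-- The polynomial substituted for the colouring variable `x_{v,j}`, given a colouring of every
gadget in every state. -/
noncomputable def subst (κ : ∀ g : K.gadgets, GadgetColouring g.1.c g.1.c') :
    K.Vertex → Fin k → MvPolynomial B.PigeonVar F
  | .pigeon i, j => X ⟨i, K.edge i j⟩
  | .left g a, j => g.1.indicator F ((κ g).left a) j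
  | .right g a _, j => g.1.indicator F ((κ g).right a) j
  | .strip t, j => if (t : ℕ) % k = j then 1 else 0

variable {F} (κ : ∀ g : K.gadgets, GadgetColouring g.1.c g.1.c')

theorem subst_rightVertex (g : K.gadgets) (a : Fin k) (j : Fin k) :
    subst F κ (K.rightVertex g a) j = g.1.indicator F ((κ g).right a) j := by
  rw [rightVertex]
  split_ifs with h
  · rfl
  · push Not at h
    rw [subst, (κ g).last_eq h.2 a h.1]

theorem subst_mem_affinePolynomials (v : K.Vertex) (j : Fin k) :
    subst F κ v j ∈ affinePolynomials B.PigeonVar F := by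
  cases v with
  | pigeon i => exact X_mem_affinePolynomials _
  | left g a => exact g.1.indicator_mem_affinePolynomials _ _
  | right g a h => exact g.1.indicator_mem_affinePolynomials _ _
  | strip t =>
    rw [subst]
    split_ifs
    · exact one_mem_affinePolynomials
    · exact zero_mem _

theorem subst_boolean (hD : 2 ≤ D) (v : K.Vertex) (j : Fin k) :
    subst F κ v j ^ 2 - subst F κ v j ∈ pcSubmodule (B.fphpConstraints F) D := by
  cases v with
  | pigeon i => exact boolean_mem_pcSubmodule _ hD
  | left g a => exact g.1.indicator_sq_sub_mem hD _ _
  | right g a h => exact g.1.indicator_sq_sub_mem hD _ _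
  | strip t =>
    rw [subst]
    split_ifs <;> simp

theorem sum_subst_sub_one_mem (hk : 0 < k) (hD : 2 ≤ D) (v : K.Vertex) :
    (∑ j, subst F κ v j) - 1 ∈ pcSubmodule (B.fphpConstraints F) D := by
  cases v with
  | pigeon i =>
    simp only [subst]
    rw [(K.edge i).sum_comp fun j => (X ⟨i, j⟩ : MvPolynomial B.PigeonVar F)]
    refine initial_mem_pcSubmodule (Or.inl (Or.inl ⟨i, rfl⟩)) ?_
    refine (totalDegree_sub _ _).trans (max_le (totalDegree_finsetSum_le fun j _ => ?_) (by simp))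
    simpa using by omega
  | left g a => simp only [subst, g.1.sum_indicator, sub_self, zero_mem]
  | right g a h => simp only [subst, g.1.sum_indicator, sub_self, zero_mem]
  | strip t =>
    have h : ∑ j : Fin k, (if (t : ℕ) % k = j then (1 : MvPolynomial B.PigeonVar F) else 0) = 1 := by
      rw [Finset.sum_eq_single ⟨(t : ℕ) % k, Nat.mod_lt _ hk⟩]
      · simp
      · intro j _ hj
        exact if_neg fun h => hj (Fin.ext h.symm)
      · simp
    simp only [subst, h, sub_self, zero_mem]

theorem subst_mul_subst_mem_of_colour_ne (hD : 2 ≤ D) (v : K.Vertex) {j j' : Fin k}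
    (h : j ≠ j') : subst F κ v j * subst F κ v j' ∈ pcSubmodule (B.fphpConstraints F) D := by
  cases v with
  | pigeon i => exact X_mul_X_mem_of_hole_ne hD i fun h' => h ((K.edge i).injective h')
  | left g a =>
    exact g.1.indicator_mul_indicator_mem hD fun s hs hs' => h (hs.symm.trans hs')
  | right g a _ =>
    exact g.1.indicator_mul_indicator_mem hD fun s hs hs' => h (hs.symm.trans hs')
  | strip t =>
    have : subst F κ (.strip t) j * subst F κ (.strip t) j' = 0 := by
      simp only [subst]
      split_ifs with h1 h2
      · exact absurd (Fin.ext (h1.symm.trans h2)) h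
      all_goals simp
    rw [this]
    exact zero_mem _

/-- A clique vertex adjacent to a strip vertex never has the colour of the latter. -/
theorem indicator_mul_subst_strip_eq_zero (g : K.gadgets) {f : Fin 3 → Fin k} {c : Fin k}
    {t : Fin K.M} (ht : (t : ℕ) % k = c) (hf : ∀ s, f s ≠ c) (j : Fin k) :
    g.1.indicator F f j * subst F κ (.strip t) j = 0 := by
  by_cases hj : c = j
  · subst hj
    rw [g.1.indicator_eq_zero hf, zero_mul]
  · rw [subst, ht, if_neg fun h => hj (Fin.ext h), mul_zero]

theorem subst_mul_subst_mem_of_edge (hD : 2 ≤ D) {v w : K.Vertex} (h : K.Edge v w) (j : Fin k) :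
    subst F κ v j * subst F κ w j ∈ pcSubmodule (B.fphpConstraints F) D := by
  cases h with
  | leftClique g a b hab =>
    exact g.1.indicator_mul_indicator_mem hD fun s hs hs' =>
      hab ((κ g).left_injective s (hs.trans hs'.symm))
  | rightClique g a b hab =>
    rw [subst_rightVertex, subst_rightVertex]
    exact g.1.indicator_mul_indicator_mem hD fun s hs hs' =>
      hab ((κ g).right_injective s (hs.trans hs'.symm))
  | leftPigeon g a ha =>
    exact g.1.indicator_mul_X_mem hD (s₀ := 0) rfl ((κ g).left_first a ha) j
  | rightPigeon g a ha =>
    rw [subst_rightVertex]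
    exact g.1.indicator_mul_X_mem hD (s₀ := 1) rfl ((κ g).right_first a ha) j
  | leftColour g a ha ha' =>
    have := indicator_mul_subst_strip_eq_zero (F := F) κ g (K.slot_left g)
      ((κ g).left_middle a ha ha') j
    rw [subst, this]
    exact zero_mem _
  | rightColour g a ha ha' =>
    rw [subst_rightVertex, indicator_mul_subst_strip_eq_zero κ g (K.slot_right g)
      ((κ g).right_middle a ha ha') j]
    exact zero_mem _
  | join g a ha hc =>
    rw [subst_rightVertex]
    exact g.1.indicator_mul_indicator_mem hD fun s hs hs' =>
      (κ g).last_ne hc a ha s (hs.trans hs'.symm)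
  | segment m hm s t hs ht hst =>
    have hne : (s : ℕ) % k ≠ (t : ℕ) % k := by
      intro hmod
      refine hst (Fin.ext (Nat.ModEq.eq_of_abs_lt hmod ?_))
      rw [Set.mem_Ico] at hs ht
      rw [abs_lt]
      omega
    have : subst F κ (.strip s) j * subst F κ (.strip t) j = 0 := by
      simp only [subst]
      split_ifs with h1 h2
      · exact absurd (h1.trans h2.symm) hne
      all_goals simp
    rw [this]
    exact zero_mem _

theorem subst_colouringConstraints (hk : 0 < k) (hD : 2 ≤ D)
    {q : MvPolynomial (K.Vertex × Fin k) F} (hq : q ∈ colouringConstraints F K.graph k) :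
    aeval (fun x => subst F κ x.1 x.2) q ∈ pcSubmodule (B.fphpConstraints F) D := by
  rcases hq with (⟨v, rfl⟩ | ⟨v, j, j', hj, rfl⟩) | ⟨u, v, j, huv, rfl⟩
  · simpa using sum_subst_sub_one_mem (F := F) κ hk hD v
  · simpa using subst_mul_subst_mem_of_colour_ne (F := F) κ hD v hj
  · simp only [map_mul, aeval_X]
    rcases (SimpleGraph.fromRel_adj _ _ _).1 huv with ⟨-, h | h⟩
    · exact subst_mul_subst_mem_of_edge κ hD h j
    · rw [mul_comm]
      exact subst_mul_subst_mem_of_edge κ hD h j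

/-- If the colouring constraints are refutable in degree `D`, then `1` is derivable from the
pigeonhole constraints in the same degree. -/
theorem one_mem_pcSubmodule_of_refutation (hk : 3 ≤ k) (hD : 2 ≤ D)
    (π : PCRefutation (colouringConstraints F K.graph k)) (hπ : π.degree ≤ D) :
    1 ∈ pcSubmodule (B.fphpConstraints F) D := by
  have κ : ∀ g : K.gadgets, GadgetColouring g.1.c g.1.c' := fun g =>
    (exists_gadgetColouring hk g.1.c g.1.c').some
  rw [← map_one (aeval (R := F) fun x : K.Vertex × Fin k => subst F κ x.1 x.2)]
  refine mem_pcSubmodule_of_subst (fun x => ?_) (fun x => ?_) (fun q hq => ?_) π hπ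
  · exact subst_mem_affinePolynomials κ x.1 x.2
  · exact subst_boolean κ hD x.1 x.2
  · exact subst_colouringConstraints κ (by omega) hD hq

end Construction

end LeftRegularBipartite

theorem mainTheorem4 {F : Type*} [Field F] {I J : Type*} [Finite I] (k : ℕ) (hk : 3 ≤ k)
    (B : LeftRegularBipartite I J k) (K : B.Construction) (d : ℕ)
    (h : ∃ π : PCRefutation (colouringConstraints F K.graph k), π.degree = d) :
    ∃ π : PCRefutation (B.fphpConstraints F), π.degree ≤ 2 * d := by
  obtain ⟨π, rfl⟩ := h
  have hd : 1 ≤ π.degree := π.one_le_degree fun q hq =>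
    one_le_totalDegree_of_mem_colouringConstraints (zero_lt_three.trans_le hk) hq
  exact exists_derivation_of_mem_pcSubmodule
    (LeftRegularBipartite.Construction.one_mem_pcSubmodule_of_refutation hk (by omega) π
      (by omega)) one_ne_zero
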